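/- Notation. Identify $\mathbb N$ with the set $\{0,1\}^*$ of binary strings via the canonical correspondence $0\leftrightarrow\lambda$ (the empty string), $1\leftrightarrow 0$, $2\leftrightarrow 1$, $3\leftrightarrow 00$, $4\leftrightarrow 01,\dots$; $l(p)$ is the length of $p$, $\chi_A$ the characteristic function of $A$ (with values the one-letter strings $0,1$), and $\perp$ a special "don't know" output. Let $W_0,W_1,\dots$ be the standard numbering of the r.e. sets. For a partial recursive mapping $U:\{0,1\}^*\times\{0,1\}^*\to\{0,1\}^*\cup\{\perp\}$, $x\in\{0,1\}^*$ and $A\subseteq\{0,1\}^*$ put (with $\min\emptyset=\infty$) $$C_U(x)=\min\{l(p):U(p,\lambda)=x\},$$ $$\overline{ic}_U(x:A)=\min\{l(p): \lambda z.U(p,z)\text{ is }A\text{-consistent and }U(p,x)=\chi_A(x)\},$$ where a partial function $f$ is $A$-consistent if $f(z)\in\{\chi_A(z),\perp\}$ for all $z\in \mathrm{dom}(f)$; $ic_U(x:A)$ is defined in the same way as $\overline{ic}_U(x:A)$ with the additional requirement that $\lambda z.U(p,z)$ is total. Call a partial recursive $U$ optimal if for every partial recursive $U'$ (of the same type) there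 is a constant $c$ such that $C_U(x)\le C_{U'}(x)+c$, $ic_U(x:A)\le ic_{U'}(x:A)+c$ and $\overline{ic}_U(x:A)\le\overline{ic}_{U'}(x:A)+c$ for all $x$ and $A$. Fix any optimal $U$ and write $C,ic,\overline{ic}$ for $C_U,ic_U,\overline{ic}_U$. A set $A$ is strongly effectively simple if it is r.e., its complement $\overline A$ is infinite, and there is a total recursive function $f$ such that for all $e$: if $W_e\subseteq\overline A$, then $\max(W_e)<f(e)$, i.e. every element of $W_e$ is less than $f(e)$. Statement. Every strongly effectively simple set $A$ has hard instances, even with respect to $\overline{ic}$: there is a constant $c$ such that $ic(x:A)\ge C(x)-c$ for infinitely many $x$, and there is a constant $c$ such that $\overline{ic}(x:A)\ge C(x)-c$ for infinitely many $x$. -/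

import Mathlib

namespace InstanceComplexity

/-- Binary strings, the elements of `{0,1}*`. -/
abbrev Str := List Bool

/-- The canonical correspondence `{0,1}* → ℕ`: strings are listed by length and then
lexicographically, `λ ↦ 0`, `0 ↦ 1`, `1 ↦ 2`, `00 ↦ 3`, `01 ↦ 4`, … -/
def strToNat (x : Str) : ℕ := x.foldl (fun n b => 2 * n + 1 + b.toNat) 0

/-- The inverse of the canonical correspondence. -/
def natToStr : ℕ → Str
  | 0 => []
  | n + 1 => natToStr (n / 2) ++ [n % 2 == 1]
decreasing_by omega

theorem strToNat_concat (x : Str) (b : Bool) :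
    strToNat (x ++ [b]) = 2 * strToNat x + 1 + b.toNat := by
  simp [strToNat, List.foldl_append]

theorem strToNat_natToStr (n : ℕ) : strToNat (natToStr n) = n := by
  induction n using Nat.strong_induction_on with
  | _ n ih =>
    cases n with
    | zero => simp [natToStr, strToNat]
    | succ n =>
      rw [natToStr, strToNat_concat, ih (n / 2) (by omega)]
      rcases Nat.mod_two_eq_zero_or_one n with h | h <;> simp [h] <;> omega

theorem natToStr_strToNat (x : Str) : natToStr (strToNat x) = x := by
  induction x using List.reverseRecOn with
  | nil => simp [natToStr, strToNat]
  | append_singleton x b ih =>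
    have h : strToNat (x ++ [b]) = (2 * strToNat x + b.toNat) + 1 := by
      rw [strToNat_concat]; omega
    rw [h, natToStr]
    cases b
    · simp [ih]
    · have h2 : (2 * strToNat x + 1) / 2 = strToNat x := by omega
      have h3 : (2 * strToNat x + 1) % 2 = 1 := by omega
      simp [h2, h3, ih]

/-- The canonical bijection between binary strings and natural numbers. -/
def strEquivNat : Str ≃ ℕ where
  toFun := strToNat
  invFun := natToStr
  left_inv := natToStr_strToNat
  right_inv := strToNat_natToStr

/-- A set of natural numbers viewed as a set of binary strings. -/
def asStrings (A : Set ℕ) : Set Str := {x | strEquivNat x ∈ A}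

/-- Partial mappings `{0,1}* × {0,1}* → {0,1}* ∪ {⊥}`. The output `none` is the halting
"don't know" answer `⊥`; an undefined value is `Part.none`. -/
abbrev Interpreter := Str → Str →. Option Str

/-- The Kolmogorov complexity `C_U(x)` (an element of `ℕ ∪ {∞}`, with `min ∅ = ∞`). -/
noncomputable def kolmogorov (U : Interpreter) (x : Str) : ℕ∞ :=
  ⨅ (p : Str) (_ : some x ∈ U p []), (p.length : ℕ∞)

open Classical in
/-- The characteristic function of `A`, with the values `0`, `1` as strings of length one. -/
noncomputable def chi (A : Set Str) (x : Str) : Str := [decide (x ∈ A)]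

/-- The partial function `f` is `A`-consistent: on its domain, it takes only the values
`χ_A(z)` and `⊥`. -/
def Consistent (A : Set Str) (f : Str →. Option Str) : Prop :=
  ∀ z, ∀ v ∈ f z, v = some (chi A z) ∨ v = none

/-- The instance complexity `ic_U(x : A)`. -/
noncomputable def ic (U : Interpreter) (x : Str) (A : Set Str) : ℕ∞ :=
  ⨅ (p : Str) (_ : (∀ z, (U p z).Dom) ∧ Consistent A (U p) ∧ some (chi A x) ∈ U p x),
    (p.length : ℕ∞)

/-- The weak instance complexity of `x` with respect to `A` in `U`, where programs need
not be total. -/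
noncomputable def icBar (U : Interpreter) (x : Str) (A : Set Str) : ℕ∞ :=
  ⨅ (p : Str) (_ : Consistent A (U p) ∧ some (chi A x) ∈ U p x), (p.length : ℕ∞)

/-- `U` is an optimal partial recursive mapping. -/
structure IsOptimal (U : Interpreter) : Prop where
  partrec : Partrec₂ U
  optimal : ∀ U' : Interpreter, Partrec₂ U' → ∃ c : ℕ, ∀ (x : Str) (A : Set Str),
    kolmogorov U x ≤ kolmogorov U' x + c ∧
    ic U x A ≤ ic U' x A + c ∧
    icBar U x A ≤ icBar U' x A + c

/-- `A` has hard instances: `ic(x : A) ≥ C(x) - c` for infinitely many `x`. -/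
def HasHardInstances (U : Interpreter) (A : Set Str) : Prop :=
  ∃ c : ℕ, {x : Str | kolmogorov U x ≤ ic U x A + c}.Infinite

/-- `A` has hard instances with respect to the weak instance complexity. -/
def HasHardInstancesBar (U : Interpreter) (A : Set Str) : Prop :=
  ∃ c : ℕ, {x : Str | kolmogorov U x ≤ icBar U x A + c}.Infinite

/-- The standard numbering of the r.e. sets: `W e` is the domain of the `e`-th partial
recursive function. -/
def W (e : ℕ) : Set ℕ := {n | ((Denumerable.ofNat Nat.Partrec.Code e).eval n).Dom}

/-- `A` is strongly effectively simple: a coinfinite r.e. set with a total recursive `f` such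
that `W e ⊆ Aᶜ` implies `max (W e) < f e` (so that `W e` is finite; void for `W e = ∅`). -/
structure StronglyEffectivelySimple (A : Set ℕ) : Prop where
  re : REPred fun n => n ∈ A
  coinfinite : Aᶜ.Infinite
  bound : ∃ f : ℕ → ℕ, Computable f ∧ ∀ e, W e ⊆ Aᶜ → ∀ n ∈ W e, n < f e

end InstanceComplexity

namespace InstanceComplexity

open Nat.Partrec (Code)

/-! ### Computability of auxiliary functions -/

/-! The instances that an `A`-consistent program answers with `0` form an r.e. subset of the
complement of `A`, so strong effective simplicity bounds them computably: by `g n` for programs of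
length at most `n` (`exists_computable_bound`). Fix a fast-growing computable sequence `a` and,
among consistent programs answering `0` somewhere at or beyond `a (k + 1)`, a shortest one `p`. Any
such answer `y` is a non-member, and every consistent program deciding it competes with `p`, so its
instance complexity is at least `|p|`. Conversely `p` yields such a `y` by search once `a (k + 1)`
is known (`exists_kolmogorov_le`). If the block of `a` after `a (k + 1)` contains a non-member, then
`a k < |p| ≤ a (k + 3)`, so `|p|` determines `k` up to three cases and `C(y) ≤ |p| + O(1)`. The
claim for `ic` follows from `icBar ≤ ic`. -/

theorem primrec_natToStr : Primrec natToStr := by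
  -- Course-of-values recursion: `l` lists the earlier values, so its length is the current
  -- argument.
  have hg : Primrec₂ fun (_ : Unit) (l : List Str) =>
      (Nat.casesOn l.length (some ([] : Str))
        fun n => l[n / 2]?.map fun x => x ++ [n % 2 == 1] : Option Str) := by
    have hbit : Primrec fun n : ℕ => (n % 2 == 1) :=
      Primrec.beq.comp (Primrec.nat_mod.comp Primrec.id (Primrec.const 2)) (Primrec.const 1)
    refine Primrec.nat_casesOn (Primrec.list_length.comp Primrec.snd) (Primrec.const _) ?_
    refine Primrec.option_map
      (Primrec.list_getElem?.comp (Primrec.snd.comp Primrec.fst)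
        (Primrec.nat_div.comp Primrec.snd (Primrec.const 2))) ?_
    exact Primrec.list_concat.comp Primrec.snd
      (hbit.comp (Primrec.snd.comp Primrec.fst))
  have h := Primrec.nat_strong_rec (fun (_ : Unit) n => natToStr n) hg (by
    intro _ n
    cases n with
    | zero => simp [natToStr]
    | succ n =>
      have h : n / 2 < n + 1 := by omega
      simp [natToStr, List.getElem?_range h])
  exact h.comp (Primrec.const ()) Primrec.id

theorem computable_sum_range {f : ℕ → ℕ} (hf : Computable f) :
    Computable fun n => ∑ i ∈ Finset.range n, f i := by
  have h : Computable fun n : ℕ =>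
      Nat.rec (motive := fun _ => ℕ) 0 (fun y s => s + f y) n :=
    Computable.nat_rec (h := fun _ (q : ℕ × ℕ) => q.2 + f q.1) Computable.id (Computable.const 0)
      (Primrec.nat_add.to_comp.comp (Computable.snd.comp Computable.snd)
        (hf.comp (Computable.fst.comp Computable.snd)))
  refine h.of_eq fun n => ?_
  induction n with
  | zero => simp
  | succ n ih => rw [Finset.sum_range_succ, ← ih]

/-- An unbounded computable sequence has a computable inverse. -/
theorem exists_computable_first_ge {a : ℕ → ℕ} (ha : Computable a) (hunb : ∀ m, ∃ j, m ≤ a j) :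
    ∃ K : ℕ → ℕ, Computable K ∧ ∀ m, m ≤ a (K m) ∧ ∀ j < K m, a j < m := by
  have hp : Computable₂ fun m j : ℕ => decide (m ≤ a j) :=
    (Primrec.nat_le.decide.to_comp).comp Computable.fst (ha.comp Computable.snd)
  refine ⟨fun m => Nat.find (hunb m), ?_, fun m => ⟨Nat.find_spec (hunb m), fun j hj => ?_⟩⟩
  · have h := Partrec.rfind hp.partrec₂
    refine Partrec.of_eq_tot h fun m => ?_
    rw [Nat.mem_rfind]
    refine ⟨by simpa using Nat.find_spec (hunb m), fun {j} hj => ?_⟩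
    simpa using Nat.find_min (hunb m) hj
  · simpa using Nat.find_min (hunb m) hj

/-! ### Strings and the canonical correspondence -/

/-- In binary, `strToNat x + 1` is the digit 1 followed by `x`. -/
theorem strToNat_bounds (x : Str) :
    2 ^ x.length ≤ strToNat x + 1 ∧ strToNat x + 1 < 2 ^ (x.length + 1) := by
  induction x using List.reverseRecOn with
  | nil => simp [strToNat]
  | append_singleton x b ih =>
    rw [strToNat_concat, List.length_append, List.length_singleton, pow_succ 2 (x.length + 1)]
    rw [pow_succ] at ih ⊢
    cases b <;> simp <;> omega

theorem length_natToStr_le (n : ℕ) : (natToStr n).length ≤ n := by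
  have h := (strToNat_bounds (natToStr n)).1
  rw [strToNat_natToStr] at h
  have := (natToStr n).length.lt_two_pow_self
  omega

/-! ### Complexity measures -/

theorem kolmogorov_le {U : Interpreter} {x p : Str} (h : some x ∈ U p []) :
    kolmogorov U x ≤ p.length := iInf₂_le p h

theorem icBar_le {U : Interpreter} {A : Set Str} {x p : Str} (hc : Consistent A (U p))
    (h : some (chi A x) ∈ U p x) : icBar U x A ≤ p.length := iInf₂_le p ⟨hc, h⟩

theorem icBar_le_ic (U : Interpreter) (x : Str) (A : Set Str) : icBar U x A ≤ ic U x A :=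
  le_iInf₂ fun _ hp => icBar_le hp.2.1 hp.2.2

theorem exists_of_icBar_le {U : Interpreter} {A : Set Str} {x : Str} {n : ℕ}
    (h : icBar U x A ≤ n) :
    ∃ p : Str, p.length ≤ n ∧ Consistent A (U p) ∧ some (chi A x) ∈ U p x := by
  have h' : icBar U x A < ((n + 1 : ℕ) : ℕ∞) :=
    lt_of_le_of_lt h (by exact_mod_cast Nat.lt_succ_self n)
  simp only [icBar, iInf_lt_iff] at h'
  obtain ⟨p, hp, hlt⟩ := h'
  exact ⟨p, Nat.lt_succ_iff.1 (by exact_mod_cast hlt), hp⟩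

theorem natToStr_mem_asStrings {A : Set ℕ} {n : ℕ} : natToStr n ∈ asStrings A ↔ n ∈ A := by
  change strToNat (natToStr n) ∈ A ↔ n ∈ A
  rw [strToNat_natToStr]

theorem chi_asStrings_natToStr {A : Set ℕ} {n : ℕ} (h : n ∉ A) :
    chi (asStrings A) (natToStr n) = [false] := by
  simpa [chi, natToStr_mem_asStrings] using h

theorem Consistent.notMem {A : Set ℕ} {f : Str →. Option Str} (hf : Consistent (asStrings A) f)
    {n : ℕ} (h : some [false] ∈ f (natToStr n)) : n ∉ A := by
  have := hf _ _ h
  simpa [chi, natToStr_mem_asStrings] using this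

/-- Up to a constant, the instance complexity of a non-member is at most its length. -/
theorem IsOptimal.exists_icBar_le {U : Interpreter} (hU : IsOptimal U) :
    ∃ c : ℕ, ∀ (A : Set ℕ) (n : ℕ), n ∉ A →
      icBar U (natToStr n) (asStrings A) ≤ ((n + c : ℕ) : ℕ∞) := by
  -- Program `p` answers `0` on the instance `p` itself and `⊥` elsewhere, which is consistent with
  -- any set omitting `p`.
  obtain ⟨c, hc⟩ := hU.optimal
    (fun p z => Part.some (bif decide (p = z) then some [false] else none)) (by
      refine Computable.partrec (f := fun q : Str × Str =>
        (bif decide (q.1 = q.2) then some [false] else none)) ?_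
      exact Computable.cond (Primrec.eq.decide.to_comp.comp Computable.fst Computable.snd)
        (Computable.const _) (Computable.const _))
  refine ⟨c, fun A n hn => (hc _ _).2.2.trans ?_⟩
  push_cast
  gcongr
  refine (icBar_le (p := natToStr n) ?_ ?_).trans (by exact_mod_cast length_natToStr_le n)
  · intro z v hv
    rw [Part.mem_some_iff] at hv
    by_cases hz : natToStr n = z
    · subst hz; left; simp [hv, chi_asStrings_natToStr hn]
    · right; simpa [hz] using hv
  · simp [chi_asStrings_natToStr hn]

/-! ### Programs answering `0` -/

/-- The pairs `(p, n)` for which `p` answers `0` on `n` form a r.e. set. -/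
theorem exists_code_answers_zero {U : Interpreter} (hU : Partrec₂ U) :
    ∃ c : Code, ∀ (p : Str) (n : ℕ),
      (c.eval (Nat.pair (Encodable.encode p) n)).Dom ↔ some [false] ∈ U p (natToStr n) := by
  have h : Partrec fun q : Str × ℕ => (U q.1 (natToStr q.2)).bind fun v =>
      ((bif decide (v = some [false]) then some 0 else none : Option ℕ) : Part ℕ) := by
    refine Partrec.bind
      (hU.comp Computable.fst (primrec_natToStr.to_comp.comp Computable.snd)) ?_
    refine Computable.ofOption (f := fun q : (Str × ℕ) × Option Str =>
      (bif decide (q.2 = some [false]) then some 0 else none : Option ℕ)) ?_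
    exact Computable.cond (Primrec.eq.decide.to_comp.comp Computable.snd (Computable.const _))
      (Computable.const _) (Computable.const _)
  obtain ⟨c, hc⟩ := Code.exists_code.1 h
  refine ⟨c, fun p n => ?_⟩
  have he : Nat.pair (Encodable.encode p) n = Encodable.encode (p, n) := by simp
  rw [hc, he]
  simp only [Encodable.encodek, Part.coe_some, Part.bind_some, Part.dom_iff_mem, Part.mem_map_iff,
    Part.mem_bind_iff]
  constructor
  · rintro ⟨_, _, ⟨v, hv, hb⟩, _⟩
    by_cases h0 : v = some [false]
    · rwa [← h0]
    · simp [h0] at hb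
  · intro hv
    exact ⟨_, 0, ⟨_, hv, by simp⟩, rfl⟩

/-- In a strongly effectively simple set, consistent programs of length at most `n` answer `0`
only on instances below a computable bound. -/
theorem StronglyEffectivelySimple.exists_computable_bound {U : Interpreter} (hU : Partrec₂ U)
    {A : Set ℕ} (hA : StronglyEffectivelySimple A) :
    ∃ g : ℕ → ℕ, Computable g ∧ ∀ (p : Str) (n y : ℕ), p.length ≤ n →
      Consistent (asStrings A) (U p) → some [false] ∈ U p (natToStr y) → y < g n := by
  obtain ⟨c, hc⟩ := exists_code_answers_zero hU
  obtain ⟨f, hf, hb⟩ := hA.bound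
  -- By currying (s-m-n), an index of the set of instances that the `j`-th program answers with `0`.
  let idx : ℕ → ℕ := fun j => Encodable.encode (c.curry (Encodable.encode (natToStr j)))
  have hidx : Computable idx :=
    Computable.encode.comp (Code.primrec₂_curry.to_comp.comp (Computable.const c)
      (Computable.encode.comp primrec_natToStr.to_comp))
  have hpow : Computable fun n : ℕ => 2 ^ (n + 1) := by
    refine Primrec.to_comp (((Primrec.nat_iterate (f := fun n : ℕ => n + 1) (g := fun _ => 1)
      (h := fun _ m => m + m) Primrec.succ (Primrec.const 1)
      (Primrec.nat_add.comp Primrec.snd Primrec.snd))).of_eq fun n => ?_)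
    induction n + 1 with
    | zero => rfl
    | succ n ih => rw [Function.iterate_succ_apply', ih, pow_succ]; ring
  -- The range covers all strings of length at most `n`. Consistency is undecidable, but
  -- inconsistent programs only enlarge the sum, as `f` is total.
  refine ⟨fun n => ∑ j ∈ Finset.range (2 ^ (n + 1)), f (idx j),
    (computable_sum_range (hf.comp hidx)).comp hpow, fun p n y hp hcons hy => ?_⟩
  have hW : ∀ m, m ∈ W (idx (strToNat p)) ↔ some [false] ∈ U p (natToStr m) := fun m => by
    simp only [W, idx, Set.mem_ofPred_eq, Denumerable.ofNat_encode, Code.eval_curry,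
      natToStr_strToNat, hc]
  have hlt : y < f (idx (strToNat p)) :=
    hb _ (fun m hm => hcons.notMem ((hW m).1 hm)) y ((hW y).2 hy)
  refine hlt.trans_le (Finset.single_le_sum (f := fun j => f (idx j)) (fun _ _ => Nat.zero_le _)
    (Finset.mem_range.2 ?_))
  have h1 := (strToNat_bounds p).2
  have h2 : 2 ^ (p.length + 1) ≤ 2 ^ (n + 1) := Nat.pow_le_pow_right (by norm_num) (by omega)
  omega

/-- Instances `y ≥ T |p|` on which `p` answers `0` can be found effectively from `p`, so that one
of them has complexity at most `|p|` up to a constant. -/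
theorem IsOptimal.exists_kolmogorov_le {U : Interpreter} (hU : IsOptimal U) {T : ℕ → ℕ}
    (hT : Computable T) :
    ∃ c : ℕ, ∀ (p : Str) (z : ℕ), T p.length ≤ z → some [false] ∈ U p (natToStr z) →
      ∃ y, T p.length ≤ y ∧ some [false] ∈ U p (natToStr y) ∧
        kolmogorov U (natToStr y) ≤ p.length + c := by
  obtain ⟨c, hc⟩ := exists_code_answers_zero hU.partrec
  -- Dovetailing: `s` codes a candidate instance together with a time bound.
  let step : Str → ℕ → Option ℕ := fun p s =>
    bif decide (T p.length ≤ s.unpair.1) &&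
      (Code.evaln s.unpair.2 c (Nat.pair (Encodable.encode p) s.unpair.1)).isSome
    then some s.unpair.1 else none
  have hstep : Computable₂ step := by
    have hy : Computable fun q : Str × ℕ => q.2.unpair.1 :=
      Computable.fst.comp (Computable.unpair.comp Computable.snd)
    have ht : Computable fun q : Str × ℕ => q.2.unpair.2 :=
      Computable.snd.comp (Computable.unpair.comp Computable.snd)
    have hlen : Computable fun q : Str × ℕ => T q.1.length :=
      hT.comp (Primrec.list_length.to_comp.comp Computable.fst)
    refine Computable.cond (Primrec.and.to_comp.comp
      (Primrec.nat_le.decide.to_comp.comp hlen hy)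
      (Primrec.option_isSome.to_comp.comp (Code.primrec_evaln.to_comp.comp
        ((ht.pair (Computable.const c)).pair ?_)))) (Computable.option_some.comp hy)
      (Computable.const none)
    exact Primrec₂.natPair.to_comp.comp (Computable.encode.comp Computable.fst) hy
  -- The threshold depends only on `|p|`, so `p` alone describes the instance found.
  obtain ⟨d, hd⟩ := hU.optimal
    (fun p _ => (Nat.rfindOpt (step p)).map fun y => some (natToStr y)) (by
      have h1 : Partrec fun q : Str × Str => Nat.rfindOpt (step q.1) :=
        (Partrec.rfindOpt hstep).comp Computable.fst
      exact h1.map (Computable.option_some.comp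
        (primrec_natToStr.to_comp.comp Computable.snd)).to₂)
  refine ⟨d, fun p z hz hpz => ?_⟩
  obtain ⟨v, hv⟩ := Part.dom_iff_mem.1 ((hc p z).2 hpz)
  obtain ⟨t, ht⟩ := Code.evaln_complete.1 hv
  have hdom : (Nat.rfindOpt (step p)).Dom := by
    refine Nat.rfindOpt_dom.2 ⟨Nat.pair z t, z, ?_⟩
    have ht' : Code.evaln t c (Nat.pair (Encodable.encode p) z) = some v := ht
    simp [step, hz, ht']
  obtain ⟨y, hy⟩ := Part.dom_iff_mem.1 hdom
  obtain ⟨s, hs⟩ := Nat.rfindOpt_spec hy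
  have hs' : (T p.length ≤ s.unpair.1 ∧
      (Code.evaln s.unpair.2 c (Nat.pair (Encodable.encode p) s.unpair.1)).isSome) ∧
        s.unpair.1 = y := by
    simpa [step, Bool.cond_eq_ite] using hs
  obtain ⟨⟨hTy, hsome⟩, rfl⟩ := hs'
  obtain ⟨w, hw⟩ := Option.isSome_iff_exists.1 hsome
  refine ⟨_, hTy, (hc p _).1 (Part.dom_iff_mem.2 ⟨w, Code.evaln_sound hw⟩), ?_⟩
  refine (hd _ ∅).1.trans ?_
  gcongr
  exact kolmogorov_le (Part.mem_map _ hy)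

/-! ### Hard instances -/

theorem StronglyEffectivelySimple.hasHardInstancesBar {U : Interpreter} (hU : IsOptimal U)
    {A : Set ℕ} (hA : StronglyEffectivelySimple A) : HasHardInstancesBar U (asStrings A) := by
  obtain ⟨g, hg, hbound⟩ := hA.exists_computable_bound hU.partrec
  obtain ⟨c₀, hc₀⟩ := hU.exists_icBar_le
  -- The term `g s` gives the lower bound on `m` below; `s + s` absorbs the constant `c₀` in the
  -- upper bound.
  let a : ℕ → ℕ := fun k => Nat.rec (motive := fun _ => ℕ) 0 (fun _ s => g s + (s + s) + 1) k
  have ha : Computable a :=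
    Computable.nat_rec (h := fun _ (q : ℕ × ℕ) => g q.2 + (q.2 + q.2) + 1) Computable.id
      (Computable.const 0) (by
        have h2 : Computable fun q : ℕ × ℕ × ℕ => q.2.2 := Computable.snd.comp Computable.snd
        exact Computable.succ.comp (Primrec.nat_add.to_comp.comp (hg.comp h2)
          (Primrec.nat_add.to_comp.comp h2 h2)))
  have ha_succ : ∀ k, a (k + 1) = g (a k) + (a k + a k) + 1 := fun _ => rfl
  have hmono : StrictMono a := strictMono_nat_of_lt_succ fun k => by rw [ha_succ]; omega
  obtain ⟨K, hK, hKspec⟩ := exists_computable_first_ge ha fun m => ⟨m, hmono.le_apply⟩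
  -- One search procedure for each guess `i` of the offset between `K m` and `k + 1`; only `i = 0,
  -- 1, 2` occur, hence the sum of three constants.
  have hT : ∀ i : ℕ, Computable fun m => a (K m - i) := fun i =>
    ha.comp (Primrec.nat_sub.to_comp.comp hK (Computable.const i))
  choose d hd using fun i => hU.exists_kolmogorov_le (hT i)
  refine ⟨d 0 + d 1 + d 2, ?_⟩
  suffices h : ∀ N, ∃ y, N ≤ y ∧ kolmogorov U (natToStr y) ≤
      icBar U (natToStr y) (asStrings A) + (d 0 + d 1 + d 2 : ℕ) by
    have hinf : {y : ℕ | kolmogorov U (natToStr y) ≤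
        icBar U (natToStr y) (asStrings A) + (d 0 + d 1 + d 2 : ℕ)}.Infinite :=
      Set.infinite_of_forall_exists_gt fun N =>
        (h (N + 1)).imp fun _ hy => ⟨hy.2, hy.1⟩
    exact (hinf.image strEquivNat.symm.injective.injOn).mono (by rintro _ ⟨y, hy, rfl⟩; exact hy)
  classical
  intro N
  obtain ⟨x, hxA, hx⟩ := hA.coinfinite.exists_gt (a (N + c₀ + 1))
  -- the block `[a (k + 1), a (k + 2))` containing `x`
  obtain ⟨k, hkN, hkx, hxk⟩ : ∃ k, N + c₀ ≤ k ∧ a (k + 1) ≤ x ∧ x < a (k + 2) := by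
    have hex : ∃ j, x < a j := ⟨x + 1, hmono.le_apply⟩
    have h1 : N + c₀ + 1 < Nat.find hex := by
      by_contra! h
      have := hmono.monotone h
      have := Nat.find_spec hex
      omega
    refine ⟨Nat.find hex - 2, by omega, ?_, ?_⟩
    · exact not_lt.1 (Nat.find_min hex (m := Nat.find hex - 2 + 1) (by omega))
    · have := Nat.find_spec hex
      rwa [show Nat.find hex - 2 + 2 = Nat.find hex by omega]
  have hP : ∃ m, ∃ p : Str, p.length = m ∧ Consistent (asStrings A) (U p) ∧
      ∃ y, a (k + 1) ≤ y ∧ some [false] ∈ U p (natToStr y) := by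
    obtain ⟨p, -, hp, hpx⟩ := exists_of_icBar_le (hc₀ A x hxA)
    exact ⟨_, p, rfl, hp, x, hkx, chi_asStrings_natToStr hxA ▸ hpx⟩
  set m := Nat.find hP with hm
  have hmin : ∀ p : Str, Consistent (asStrings A) (U p) → ∀ y, a (k + 1) ≤ y →
      some [false] ∈ U p (natToStr y) → m ≤ p.length := fun p hp y hy hpy =>
    Nat.find_min' hP ⟨p, rfl, hp, y, hy, hpy⟩
  obtain ⟨p, hpm, hp, z, hz, hpz⟩ := Nat.find_spec hP
  rw [← hm] at hpm
  -- A consistent program of length at most `a k` answers `0` only below `g (a k) < a (k + 1)`.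
  have hlow : a k < m := by
    refine lt_of_not_ge fun h => ?_
    have h1 := hbound p (a k) z (hpm.trans_le h) hp hpz
    have h2 := ha_succ k
    omega
  -- The non-member `x` has a program of length at most `x + c₀`, where `x < a (k + 2)` and `c₀ ≤ k
  -- ≤ a (k + 2)`.
  have hupp : m ≤ a (k + 3) := by
    obtain ⟨q, hq, hqc, hqx⟩ := exists_of_icBar_le (hc₀ A x hxA)
    have h1 := hmin q hqc x hkx (chi_asStrings_natToStr hxA ▸ hqx)
    have h2 : a (k + 3) = g (a (k + 2)) + (a (k + 2) + a (k + 2)) + 1 := ha_succ (k + 2)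
    have h3 : k + 2 ≤ a (k + 2) := hmono.le_apply
    omega
  obtain ⟨i, hi, hiK⟩ : ∃ i, i ≤ 2 ∧ K m - i = k + 1 := by
    have h1 : k < K m := by
      by_contra! h
      have := hmono.monotone h
      have := (hKspec m).1
      omega
    have h2 : K m ≤ k + 3 := by
      by_contra! h
      have := (hKspec m).2 _ h
      omega
    exact ⟨K m - (k + 1), by omega, by omega⟩
  have hTm : a (K p.length - i) = a (k + 1) := by rw [hpm, hiK]
  obtain ⟨y, hy, hpy, hCy⟩ := hd i p z (hTm.trans_le hz) hpz
  rw [hTm] at hy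
  have hdi : d i ≤ d 0 + d 1 + d 2 := by interval_cases i <;> omega
  refine ⟨y, ?_, hCy.trans ?_⟩
  · have : k + 1 ≤ a (k + 1) := hmono.le_apply
    omega
  -- Consistency of `p` makes `y` a non-member, so any program deciding `y` answers `0` there and
  -- falls under the minimality of `m`.
  · have hic : (p.length : ℕ∞) ≤ icBar U (natToStr y) (asStrings A) := by
      refine le_iInf₂ fun q hq => ?_
      rw [hpm]
      exact_mod_cast hmin q hq.1 y hy (chi_asStrings_natToStr (hp.notMem hpy) ▸ hq.2)
    exact add_le_add hic (by exact_mod_cast hdi)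

end InstanceComplexity

theorem mainTheorem12 (U : InstanceComplexity.Interpreter) (hU : InstanceComplexity.IsOptimal U)
    (A : Set ℕ) (hA : InstanceComplexity.StronglyEffectivelySimple A) :
    InstanceComplexity.HasHardInstances U (InstanceComplexity.asStrings A) ∧
      InstanceComplexity.HasHardInstancesBar U (InstanceComplexity.asStrings A) := by
  have h := hA.hasHardInstancesBar hU
  refine ⟨?_, h⟩
  obtain ⟨c, hc⟩ := h
  exact ⟨c, hc.mono fun x hx =>
    le_trans hx (add_le_add_left (InstanceComplexity.icBar_le_ic U x _) _)⟩
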